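/- Let $m\ge 1$ and $s\ge 2$ be integers, and let $\mathbb{RP}^m=S^m/(x\sim -x)$. Let $\mathrm P$ be the quotient of $(S^m)^s$ by the involution $(x_1,\dots,x_s)\mapsto(-x_1,\dots,-x_s)$, and let $\pi_s\colon \mathrm P\to(\mathbb{RP}^m)^s$ be the projection $[x_1,\dots,x_s]\mapsto([x_1],\dots,[x_s])$. For a map $p\colon E\to B$, $\operatorname{secat}(p)$ is the least $n\ge 0$ such that $B$ has a cover by $n+1$ open sets on each of which $p$ has a continuous section. For a path connected space $X$, $\operatorname{TC}_s(X)=\operatorname{secat}(e_s)$, where $e_s\colon X^{[0,1]}\to X^s$, $e_s(\gamma)=\big(\gamma(\tfrac{0}{s-1}),\gamma(\tfrac{1}{s-1}),\dots,\gamma(\tfrac{s-1}{s-1})\big)$; an $s$-motion planning algorithm for $X$ with $n$ local rules is an open cover of $X^s$ by $n$ sets together with a continuous section of $e_s$ on each of them. Let $G_s=(\mathbb Z_2)^{s-1}$ (discrete), with generators $\sigma_1,\dots,\sigma_{s-1}$, act on $(S^m)^s$ by letting $\sigma_i$ change the sign of the $i$-th coordinate. Put $k=\operatorname{secat}(\pi_s)$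 and let $J_k(G_s)=G_s*\cdots*G_s$ be the join of $k+1$ copies of $G_s$, that is, the space of barycentric expressions $\sum_{\ell=0}^k t_\ell g_\ell$ ($g_\ell\in G_s$, $t_\ell\ge 0$, $\sum_\ell t_\ell=1$), on which $G_s$ acts by $g\cdot\sum_\ell t_\ell g_\ell=\sum_\ell t_\ell\,(g g_\ell)$. For $0\le j\le k$ let $U_j\subset J_k(G_s)$ be the subspace where $t_j>0$, and let $$D_s=\{(x_1,\dots,x_s)\in(S^m)^s : x_i=x_s\text{ for some } i\in\{1,\dots,s-1\}\}.$$ Suppose that $\phi_s\colon (S^m)^s\to J_k(G_s)$ is a continuous $G_s$-equivariant map such that $$\phi_s(x_1,\dots,x_{s-1},-x_s)=\sigma_1\cdots\sigma_{s-1}\cdot\phi_s(x_1,\dots,x_s)\qquad\text{for all }(x_1,\dots,x_s)\in(S^m)^s,$$ and that at least one of the following conditions holds: 1. for every $j\in\{0,\dots,k\}$, $\phi_s(D_s)$ intersects at most one connected component of $U_j$; 2. for some $j_0\in\{0,\dots,k\}$, $\phi_s(D_s)$ is contained in a single connected component of $U_{j_0}$. Then there is an $s$-motion planning algorithm for $\mathbb{RP}^m$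 with $\operatorname{secat}(\pi_s)+1$ local rules, and $\operatorname{TC}_s(\mathbb{RP}^m)=\operatorname{secat}(\pi_s)$. -/

import Mathlib

open scoped unitInterval

noncomputable section

/-- The unit sphere `S^m` in `ℝ^(m+1)`. -/
abbrev Sph (m : ℕ) : Type := Metric.sphere (0 : EuclideanSpace ℝ (Fin (m + 1))) 1

/-- The group `ℤ₂ = {1, -1}` acts on `S^m` through the antipodal involution. -/
instance sphAction (m : ℕ) : MulAction ℤˣ (Sph m) where
  smul e x := if e = 1 then x else -x
  one_smul x := if_pos rfl
  mul_smul a b x := by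
    change (if a * b = 1 then x else -x) =
      if a = 1 then (if b = 1 then x else -x) else -(if b = 1 then x else -x)
    rcases Int.units_eq_one_or a with rfl | rfl <;>
      rcases Int.units_eq_one_or b with rfl | rfl <;> simp

theorem neg_one_smul_sph {m : ℕ} (x : Sph m) : (-1 : ℤˣ) • x = -x := if_neg (by decide)

/-- Real projective space `ℝP^m`: the orbit space of `S^m` under the antipodal involution. -/
abbrev RProj (m : ℕ) : Type := Quotient (MulAction.orbitRel ℤˣ (Sph m))

/-- The product `(S^m)^s` with `s = r + 1` factors. The last coordinate `x_s` is the one with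
index `Fin.last r`; the coordinates `x_1, …, x_{s-1}` are those with index `i.castSucc`
for `i : Fin r`. -/
abbrev SphProd (m r : ℕ) : Type := Fin (r + 1) → Sph m

/-- The diagonal action of `{1, -1}` on `(S^m)^s`; here `-1` acts as the involution
`δ (x_1, …, x_s) = (-x_1, …, -x_s)`. -/
instance diagAction (m r : ℕ) : MulAction ℤˣ (SphProd m r) := Pi.mulAction ℤˣ

instance diagSMul (m r : ℕ) : SMul ℤˣ (SphProd m r) := (diagAction m r).toSMul

/-- The projective product space `P_{(m,…,m)}`: the orbit space of `(S^m)^s`, `s = r + 1`, under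
the involution `δ`. -/
abbrev ProjProd (m r : ℕ) : Type := Quotient (MulAction.orbitRel ℤˣ (SphProd m r))

/-- The projection `π_s : P_{(m,…,m)} → (ℝP^m)^s`, `s = r + 1`, sending `[x_1, …, x_s]` to
`([x_1], …, [x_s])`. -/
def projProdCover (m r : ℕ) : ProjProd m r → (Fin (r + 1) → RProj m) :=
  Quotient.lift (fun x i => Quotient.mk (MulAction.orbitRel ℤˣ (Sph m)) (x i)) (by
    rintro x y ⟨e, rfl⟩
    funext i
    exact Quotient.sound ⟨e, rfl⟩)

/-! ### Sectional category and higher topological complexity -/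

/-- A system of `n` continuous local sections of `p : E → B`, defined on open sets that
cover `B`. -/
structure LocalSections {E B : Type*} [TopologicalSpace E] [TopologicalSpace B]
    (p : E → B) (n : ℕ) where
  /-- the local domains -/
  dom : Fin n → TopologicalSpace.Opens B
  /-- the local domains cover the base -/
  covers : ∀ b : B, ∃ i, b ∈ dom i
  /-- the local sections -/
  sec : ∀ i, C(dom i, E)
  /-- each of them is a section of `p` -/
  proj_sec : ∀ i (b : dom i), p (sec i b) = b

/-- The (reduced) sectional category, or reduced Schwarz genus, of `p`: the least `n` for which
the base has a cover by `n + 1` open sets on each of which `p` has a continuous section, and `⊤`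
if there is no such `n`. -/
def secat {E B : Type*} [TopologicalSpace E] [TopologicalSpace B] (p : E → B) : ℕ∞ :=
  sInf {k : ℕ∞ | ∃ n : ℕ, k = n ∧ Nonempty (LocalSections p (n + 1))}

/-- The time `i / r` in `[0, 1]`, for `0 ≤ i ≤ r`. -/
def evalTime (r : ℕ) (i : Fin (r + 1)) : I :=
  ⟨(i : ℝ) / r, by positivity,
    div_le_one_of_le₀ (by exact_mod_cast Nat.lt_succ_iff.mp i.isLt) (by positivity)⟩

/-- The evaluation map `e_s : X^[0,1] → X^s`, `s = r + 1`, taking `γ` to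
`(γ(0/(s-1)), γ(1/(s-1)), …, γ((s-1)/(s-1)))`. Paths carry the compact-open topology. -/
def pathEval (r : ℕ) (X : Type*) [TopologicalSpace X] : C(I, X) → (Fin (r + 1) → X) :=
  fun γ i => γ (evalTime r i)

/-- An `s`-motion planning algorithm for `X` with `n` local rules, `s = r + 1`. -/
abbrev MotionPlanner (r : ℕ) (X : Type*) [TopologicalSpace X] (n : ℕ) :=
  LocalSections (pathEval r X) n

/-- The higher topological complexity `TC_s(X)`, `s = r + 1`. -/
def higherTC (r : ℕ) (X : Type*) [TopologicalSpace X] : ℕ∞ := secat (pathEval r X)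

/-! ### Join powers -/

/-- Two barycentric expressions `∑ t_ℓ x_ℓ` agree if their weights agree and their vertices agree
wherever the weight is positive. -/
def joinSetoid (k : ℕ) (X : Type*) :
    Setoid (stdSimplex ℝ (Fin (k + 1)) × (Fin (k + 1) → X)) where
  r p q := p.1 = q.1 ∧ ∀ l, 0 < (p.1 : Fin (k + 1) → ℝ) l → p.2 l = q.2 l
  iseqv :=
    { refl := fun _ => ⟨rfl, fun _ _ => rfl⟩
      symm := fun h => ⟨h.1.symm, fun l hl => (h.2 l (by rw [h.1]; exact hl)).symm⟩
      trans := fun h h' =>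
        ⟨h.1.trans h'.1, fun l hl => (h.2 l hl).trans (h'.2 l (by rw [← h.1]; exact hl))⟩ }

/-- The join power `J_k(X) = X * ⋯ * X` with `k + 1` factors: the space of barycentric
expressions `t_0 x_0 + ⋯ + t_k x_k` (`t_ℓ ≥ 0`, `∑ t_ℓ = 1`, `x_ℓ ∈ X`), with the quotient
topology. -/
abbrev JoinPower (k : ℕ) (X : Type*) := Quotient (joinSetoid k X)

/-- The group `G` acts on `J_k(G)` diagonally on the vertices, preserving barycentric
coordinates: `g • ∑ t_ℓ g_ℓ = ∑ t_ℓ (g g_ℓ)`. -/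
instance joinAction (k : ℕ) (G : Type*) [Group G] : MulAction G (JoinPower k G) where
  smul g := Quotient.map (fun p => (p.1, fun l => g * p.2 l))
    (fun _ _ h => ⟨h.1, fun l hl => congrArg (g * ·) (h.2 l hl)⟩)
  one_smul p := by
    induction p using Quotient.inductionOn with
    | h p => exact Quotient.sound ⟨rfl, fun l _ => one_mul _⟩
  mul_smul a b p := by
    induction p using Quotient.inductionOn with
    | h p => exact Quotient.sound ⟨rfl, fun l _ => mul_assoc _ _ _⟩

/-- The barycentric coordinate `t_j` on `J_k(X)`. -/
def baryCoord {k : ℕ} {X : Type*} (j : Fin (k + 1)) : JoinPower k X → ℝ :=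
  Quotient.lift (fun p => (p.1 : Fin (k + 1) → ℝ) j)
    (fun _ _ h => congrArg (fun t : stdSimplex ℝ (Fin (k + 1)) => (t : Fin (k + 1) → ℝ) j) h.1)

/-- The subset `U_j = {t_j > 0}` of `J_k(X)`. -/
def joinOpen {k : ℕ} {X : Type*} (j : Fin (k + 1)) : Set (JoinPower k X) :=
  {p | 0 < baryCoord j p}

/-- `C` is a connected component of the subspace `U`. -/
def IsComponentOf {X : Type*} [TopologicalSpace X] (C U : Set X) : Prop :=
  ∃ x ∈ U, C = connectedComponentIn U x

/-! ### The group `G_s` -/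

/-- The group `G_s = (ℤ₂)^(s-1)`, `s = r + 1`. Its topology is discrete. -/
abbrev SignGroup (r : ℕ) : Type := Fin r → ℤˣ

theorem signGroup_discrete (r : ℕ) : DiscreteTopology (SignGroup r) := inferInstance

/-- The generator `σ_i` of `G_s`. -/
def sigmaGen {r : ℕ} (i : Fin r) : SignGroup r := Pi.mulSingle i (-1)

/-- The group `G_s` acts on `(S^m)^s` by `(g • x)_i = g_i x_i` for `i < s` and `(g • x)_s = x_s`;
so `σ_i` changes the sign of the `i`-th coordinate. -/
instance signAction (m r : ℕ) : MulAction (SignGroup r) (SphProd m r) where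
  smul g x := Fin.snoc (α := fun _ => Sph m) (fun i : Fin r => g i • x i.castSucc) (x (Fin.last r))
  one_smul x := by
    funext i
    change Fin.snoc (α := fun _ => Sph m) (fun i : Fin r => (1 : ℤˣ) • x i.castSucc)
      (x (Fin.last r)) i = x i
    refine Fin.lastCases ?_ (fun i => ?_) i <;> simp
  mul_smul a b x := by
    funext i
    change Fin.snoc (α := fun _ => Sph m) (fun i : Fin r => (a i * b i) • x i.castSucc)
      (x (Fin.last r)) i = Fin.snoc (α := fun _ => Sph m) (fun i : Fin r => a i •
        Fin.snoc (α := fun _ => Sph m) (fun i : Fin r => b i • x i.castSucc)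
          (x (Fin.last r)) i.castSucc)
        (Fin.snoc (α := fun _ => Sph m) (fun i : Fin r => b i • x i.castSucc)
          (x (Fin.last r)) (Fin.last r)) i
    refine Fin.lastCases ?_ (fun i => ?_) i <;> simp [mul_smul]

theorem signAction_castSucc {m r : ℕ} (g : SignGroup r) (x : SphProd m r) (i : Fin r) :
    (g • x) i.castSucc = g i • x i.castSucc :=
  Fin.snoc_castSucc (α := fun _ => Sph m) (x (Fin.last r)) (fun i : Fin r => g i • x i.castSucc) i

theorem signAction_last {m r : ℕ} (g : SignGroup r) (x : SphProd m r) :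
    (g • x) (Fin.last r) = x (Fin.last r) :=
  Fin.snoc_last (α := fun _ => Sph m) (x (Fin.last r)) (fun i : Fin r => g i • x i.castSucc)

/-- The set `D_s` of all `(x_1, …, x_s)` with `x_i = x_s` for some `i < s`. -/
def pivotDiag (m r : ℕ) : Set (SphProd m r) :=
  {x | ∃ i : Fin r, x i.castSucc = x (Fin.last r)}

end

open Topology

/-! ### Sectional category -/

/-! Lower bound: lift a path in `RProj m` to the sphere and record the lift at the times i/r. The
two lifts differ by a global sign, so this gives a continuous map from the path space to `ProjProd m
r` over the base, and sections of e_s push forward to sections of π_s (`exists_lift_pathEval`).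

Upper bound: fix a vertex v_j in each join factor and let O_j be the preimage under φ of its open
star, minus D_s. Equivariance under G_s, with the rule for the last sign, makes O_j meet each fibre
over the base in at most one antipodal pair (`eq_or_eq_neg_of_mem_joinStar`). Off D_s, the points
-y_i and y_s are never antipodal, so the segments joining them avoid the origin; projecting them
gives a path through [y_1], …, [y_s] which is unchanged under y ↦ -y (`pivotPath`). Hence each O_j
yields a local rule on its open image (`nonempty_motionPlanner`).

Either condition on φ(D_s) is used to choose the v_j so that removing D_s does not spoil the cover.
Stars are open and closed in U_j, so one component of U_j sees one star only, and G_s has another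
vertex to spare. -/

theorem secat_le_of_localSections {E B : Type*} [TopologicalSpace E] [TopologicalSpace B]
    {p : E → B} {n : ℕ} (S : LocalSections p (n + 1)) : secat p ≤ n :=
  sInf_le ⟨n, rfl, ⟨S⟩⟩

/-- Local sections of `p` push forward along a map over the base. -/
def LocalSections.map {E E' B : Type*} [TopologicalSpace E] [TopologicalSpace E']
    [TopologicalSpace B] {p : E → B} {p' : E' → B} (f : C(E, E')) (hf : ∀ e, p' (f e) = p e)
    {n : ℕ} (S : LocalSections p n) : LocalSections p' n where
  dom := S.dom
  covers := S.covers
  sec i := f.comp (S.sec i)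
  proj_sec i b := (hf _).trans (S.proj_sec i b)

theorem secat_le_secat_of_map {E E' B : Type*} [TopologicalSpace E] [TopologicalSpace E']
    [TopologicalSpace B] {p : E → B} {p' : E' → B} (f : C(E, E')) (hf : ∀ e, p' (f e) = p e) :
    secat p' ≤ secat p := by
  refine le_sInf ?_
  rintro _ ⟨n, rfl, ⟨S⟩⟩
  exact secat_le_of_localSections (S.map f hf)

/-! ### The covering of projective space by the sphere -/

instance continuousConstSMul_sph (m : ℕ) : ContinuousConstSMul ℤˣ (Sph m) where
  continuous_const_smul e := by
    rcases Int.units_eq_one_or e with rfl | rfl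
    · simpa only [one_smul] using continuous_id'
    · simpa only [neg_one_smul_sph] using continuous_neg

theorem sph_ne_neg {m : ℕ} (x : Sph m) : x ≠ -x :=
  ne_neg_of_mem_unit_sphere ℝ x

instance isCancelSMul_sph (m : ℕ) : IsCancelSMul ℤˣ (Sph m) where
  right_cancel' a b x h := by
    rcases Int.units_eq_one_or a with rfl | rfl <;> rcases Int.units_eq_one_or b with rfl | rfl
    · rfl
    · exact absurd (by simpa only [one_smul, neg_one_smul_sph] using h) (sph_ne_neg x)
    · exact absurd (by simpa only [one_smul, neg_one_smul_sph] using h.symm) (sph_ne_neg x)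
    · rfl

/-- The projection of the sphere onto projective space. -/
noncomputable def sphProj (m : ℕ) : Sph m → RProj m := Quotient.mk (MulAction.orbitRel ℤˣ (Sph m))

theorem sphProj_isQuotientCoveringMap (m : ℕ) : IsQuotientCoveringMap (sphProj m) ℤˣ :=
  isQuotientCoveringMap_quotientMk_of_properlyDiscontinuousSMul

theorem sphProj_eq_iff {m : ℕ} {x y : Sph m} :
    sphProj m x = sphProj m y ↔ ∃ e : ℤˣ, x = e • y := by
  rw [(sphProj_isQuotientCoveringMap m).apply_eq_iff_mem_orbit]
  exact ⟨fun ⟨e, h⟩ => ⟨e, h.symm⟩, fun ⟨e, h⟩ => ⟨e, h.symm⟩⟩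

theorem sphProj_neg {m : ℕ} (x : Sph m) : sphProj m (-x) = sphProj m x :=
  sphProj_eq_iff.2 ⟨-1, (neg_one_smul_sph x).symm⟩

/-- The projection of `(S^m)^s` onto `(ℝP^m)^s`. -/
noncomputable def sphProdProj (m r : ℕ) : SphProd m r → (Fin (r + 1) → RProj m) := Pi.map fun _ => sphProj m

/-- Openness is what survives products and restriction to open subsets; a bare quotient map would
not do. -/
theorem sphProdProj_isOpenQuotientMap (m r : ℕ) : IsOpenQuotientMap (sphProdProj m r) :=
  .piMap fun _ => (sphProj_isQuotientCoveringMap m).isOpenQuotientMap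

/-! ### Lifting paths from projective space to the sphere -/

/-- The projection to the base of the pullback of an open map is open. -/
theorem isOpenMap_fst_pullback {A B E : Type*} [TopologicalSpace A] [TopologicalSpace B]
    [TopologicalSpace E] {f : A → B} {p : E → B} (hf : Continuous f) (hp : IsOpenMap p) :
    IsOpenMap fun a : {a : A × E // f a.1 = p a.2} => a.1.1 := by
  refine IsOpenMap.of_nhds_le fun ⟨⟨a, x⟩, hax⟩ S hS => ?_
  rw [Filter.mem_map, nhds_subtype_eq_comap, Filter.mem_comap] at hS
  obtain ⟨T, hT, hTS⟩ := hS
  obtain ⟨N, hN, M, hM, hNM⟩ := mem_nhds_prod_iff.1 hT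
  have hpM : f ⁻¹' (p '' M) ∈ 𝓝 a :=
    hf.continuousAt.preimage_mem_nhds (by rw [hax]; exact hp.image_mem_nhds hM)
  filter_upwards [hN, hpM] with b hbN ⟨y, hyM, hy⟩
  exact hTS (a := ⟨(b, y), hy.symm⟩) (hNM ⟨hbN, hyM⟩)

/-- Paths in `ℝP^m` together with a lift of their starting point. -/
abbrev PointedPath (m : ℕ) : Type := {a : C(I, RProj m) × Sph m // a.1 0 = sphProj m a.2}

/-- The map taking a path `γ` in `ℝP^m` to `[γ̃(0/r), …, γ̃(r/r)]` for a lift `γ̃` of `γ`. -/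
theorem exists_lift_pathEval (m r : ℕ) :
    ∃ Φ : C(C(I, RProj m), ProjProd m r), ∀ γ, projProdCover m r (Φ γ) = pathEval r (RProj m) γ := by
  have hq := sphProj_isQuotientCoveringMap m
  have cov : IsCoveringMap (sphProj m) := hq.isCoveringMap
  let H : C(I × PointedPath m, RProj m) := ⟨fun z => z.2.1.1 z.1, by fun_prop⟩
  let f : C(PointedPath m, Sph m) := ⟨fun a => a.1.2, by fun_prop⟩
  have H0 : ∀ a, H (0, a) = sphProj m (f a) := fun a => a.2
  let L : C(I × PointedPath m, Sph m) := cov.liftHomotopy H f H0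
  have hL : ∀ t a, sphProj m (L (t, a)) = a.1.1 t := fun t a =>
    congrFun (cov.liftHomotopy_lifts H f H0) (t, a)
  have hL0 : ∀ a, L (0, a) = a.1.2 := cov.liftHomotopy_zero H f H0
  let F : C(PointedPath m, ProjProd m r) :=
    ⟨fun a => Quotient.mk _ (fun i => L (evalTime r i, a) : SphProd m r),
      continuous_quot_mk.comp (continuous_pi fun i => L.continuous.comp (by fun_prop))⟩
  let P : C(PointedPath m, C(I, RProj m)) := ⟨fun a => a.1.1, by fun_prop⟩
  have hP : IsQuotientMap P := by
    refine IsOpenMap.isQuotientMap ?_ P.continuous fun γ => ?_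
    · exact isOpenMap_fst_pullback (f := fun γ : C(I, RProj m) => γ 0) (by fun_prop)
        hq.isOpenQuotientMap.isOpenMap
    · obtain ⟨x, hx⟩ := hq.surjective (γ 0)
      exact ⟨⟨(γ, x), hx.symm⟩, rfl⟩
  -- Two starting lifts differ by a sign e. By uniqueness of lifts, so do the whole lifted paths,
  -- hence the class in `ProjProd m r` is the same.
  have hF : Function.FactorsThrough F P := by
    rintro ⟨⟨γ, x⟩, hx⟩ ⟨⟨γ', x'⟩, hx'⟩ (rfl : γ = γ')
    obtain ⟨e, he⟩ := sphProj_eq_iff.1 (hx.symm.trans hx')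
    refine Quotient.sound ⟨e, ?_⟩
    have key : (fun t => e • L (t, ⟨(γ, x'), hx'⟩)) = fun t => L (t, ⟨(γ, x), hx⟩) := by
      refine cov.eq_of_comp_eq ?_ ?_ ?_ 0 ?_
      · exact (L.continuous.comp (by fun_prop)).const_smul e
      · exact L.continuous.comp (by fun_prop)
      · funext t
        exact (hq.map_smul e).trans ((hL t ⟨(γ, x'), hx'⟩).trans (hL t ⟨(γ, x), hx⟩).symm)
      · simpa only [hL0] using he.symm
    funext i
    exact congrFun key (evalTime r i)
  refine ⟨hP.lift F hF, fun γ => ?_⟩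
  obtain ⟨a, rfl⟩ := hP.surjective γ
  have : hP.lift F hF (P a) = F a := DFunLike.congr_fun (hP.lift_comp F hF) a
  rw [this]
  funext i
  exact hL _ a

theorem secat_projProdCover_le_higherTC (m r : ℕ) :
    secat (projProdCover m r) ≤ higherTC r (RProj m) := by
  obtain ⟨Φ, hΦ⟩ := exists_lift_pathEval m r
  exact secat_le_secat_of_map Φ hΦ

/-! ### Open stars in join powers -/

/-- The open star in `J_k(X)` of the vertex `x` of the `j`-th join factor. -/
def joinStar {k : ℕ} {X : Type*} (j : Fin (k + 1)) (x : X) : Set (JoinPower k X) :=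
  {p | p.lift (fun q => 0 < (q.1 : Fin (k + 1) → ℝ) j ∧ q.2 j = x) fun _ _ h => propext
    ⟨fun hp => ⟨h.1 ▸ hp.1, h.2 j hp.1 ▸ hp.2⟩,
      fun hq => ⟨h.1 ▸ hq.1, (h.2 j (h.1 ▸ hq.1)).trans hq.2⟩⟩}

section JoinStar

variable {k : ℕ} {X : Type*} {j : Fin (k + 1)} {x y : X} {p : JoinPower k X}

theorem mem_joinOpen_iff : p ∈ joinOpen j ↔ ∃ x, p ∈ joinStar j x := by
  induction p using Quotient.inductionOn with
  | h p => exact ⟨fun h => ⟨p.2 j, h, rfl⟩, fun ⟨_, h, _⟩ => h⟩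

theorem joinStar_subset_joinOpen : joinStar j x ⊆ joinOpen (X := X) j :=
  fun _ h => mem_joinOpen_iff.2 ⟨x, h⟩

/-- Where the j-th weight is positive the j-th vertex is well defined, so U_j is the disjoint union
of its stars. -/
theorem eq_of_mem_joinStar (hx : p ∈ joinStar j x) (hy : p ∈ joinStar j y) : x = y := by
  induction p using Quotient.inductionOn with
  | h p => exact hx.2.symm.trans hy.2

theorem smul_mem_joinStar {G : Type*} [Group G] {p : JoinPower k G} {g : G} (h : G)
    (hp : p ∈ joinStar j g) : h • p ∈ joinStar j (h * g) := by
  induction p using Quotient.inductionOn with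
  | h p => exact ⟨hp.1, congrArg (h * ·) hp.2⟩

theorem exists_mem_joinOpen (p : JoinPower k X) : ∃ j, p ∈ joinOpen j := by
  induction p using Quotient.inductionOn with
  | h p =>
    by_contra! h
    have h0 : ∑ j, (p.1 : Fin (k + 1) → ℝ) j ≤ 0 :=
      Finset.sum_nonpos fun j _ => not_lt.1 (h j)
    have h1 : ∑ j, (p.1 : Fin (k + 1) → ℝ) j = 1 := p.1.2.2
    linarith

theorem isOpen_joinStar [TopologicalSpace X] [DiscreteTopology X] (j : Fin (k + 1)) (x : X) :
    IsOpen (joinStar j x : Set (JoinPower k X)) := by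
  refine isQuotientMap_quot_mk.isOpen_preimage.1 ?_
  have h1 : IsOpen {q : stdSimplex ℝ (Fin (k + 1)) × (Fin (k + 1) → X) |
      0 < (q.1 : Fin (k + 1) → ℝ) j} :=
    isOpen_lt continuous_const
      ((continuous_apply j).comp (continuous_subtype_val.comp continuous_fst))
  have h2 : IsOpen {q : stdSimplex ℝ (Fin (k + 1)) × (Fin (k + 1) → X) | q.2 j = x} :=
    (isOpen_discrete ({x} : Set X)).preimage
      ((continuous_apply (A := fun _ : Fin (k + 1) => X) j).comp continuous_snd)
  exact h1.inter h2

/-- An open star is a union of connected components of `joinOpen j`. -/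
theorem connectedComponentIn_subset_joinStar [TopologicalSpace X] [DiscreteTopology X]
    (hp : p ∈ joinStar j x) : connectedComponentIn (joinOpen j) p ⊆ joinStar j x := by
  refine isPreconnected_connectedComponentIn.subset_left_of_subset_union (isOpen_joinStar j x)
    (isOpen_iUnion fun y => isOpen_iUnion fun _ : y ≠ x => isOpen_joinStar j y) ?_ ?_
    ⟨p, mem_connectedComponentIn (joinStar_subset_joinOpen hp), hp⟩
  · simp only [Set.disjoint_iUnion_right]
    exact fun y hy => Set.disjoint_left.2 fun q hq hq' => hy (eq_of_mem_joinStar hq' hq)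
  · intro q hq
    obtain ⟨y, hy⟩ := mem_joinOpen_iff.1 (connectedComponentIn_subset _ _ hq)
    by_cases hyx : y = x
    · exact Or.inl (hyx ▸ hy)
    · exact Or.inr (Set.mem_iUnion₂.2 ⟨y, hyx, hy⟩)

end JoinStar

/-! ### Paths through a pivot -/

/-- The weight of the `i`-th vertex along the zigzag path at time `t`: a tent function which takes
the value `1` at `i / r` and is supported in `|r t - i| < 1 / 2`. -/
def tent (r : ℕ) (i : Fin r) (t : I) : ℝ := max 0 (1 - 2 * |r * (t : ℝ) - i|)

theorem continuous_tent (r : ℕ) (i : Fin r) : Continuous (tent r i) := by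
  unfold tent; fun_prop

theorem tent_nonneg (r : ℕ) (i : Fin r) (t : I) : 0 ≤ tent r i t := le_max_left _ _

/-- In the variable r t the peaks are at distinct integers and each tent has half-width 1/2, so the
supports do not overlap. -/
theorem tent_eq_zero_of_ne {r : ℕ} {i j : Fin r} {t : I} (hi : 0 < tent r i t) (hij : j ≠ i) :
    tent r j t = 0 := by
  have h1 : |r * (t : ℝ) - i| < 1 / 2 := by
    rcases lt_max_iff.1 hi with h | h <;> linarith
  have h2 : (1 : ℝ) ≤ |(j : ℝ) - i| := by
    have : (j : ℤ) - i ≠ 0 := by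
      rw [sub_ne_zero]; exact_mod_cast Fin.val_ne_of_ne hij
    exact_mod_cast Int.one_le_abs this
  have h3 : |(j : ℝ) - i| ≤ |r * (t : ℝ) - j| + |r * (t : ℝ) - i| := by
    have := abs_sub (r * (t : ℝ) - i) (r * (t : ℝ) - j)
    rw [show r * (t : ℝ) - i - (r * (t : ℝ) - j) = j - i by ring] at this
    linarith
  exact max_eq_left (by linarith)

theorem mul_evalTime {r : ℕ} (hr : 1 ≤ r) (i : Fin (r + 1)) : r * (evalTime r i : ℝ) = i := by
  have : (r : ℝ) ≠ 0 := by positivity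
  change (r : ℝ) * ((i : ℝ) / r) = i
  field_simp

theorem tent_evalTime_castSucc {r : ℕ} (hr : 1 ≤ r) (i : Fin r) :
    tent r i (evalTime r i.castSucc) = 1 := by
  simp [tent, mul_evalTime hr]

/-- The last peak is at r - 1, so at time 1 only the pivot y_s remains. -/
theorem tent_evalTime_last {r : ℕ} (hr : 1 ≤ r) (i : Fin r) :
    tent r i (evalTime r (Fin.last r)) = 0 := by
  have : (i : ℝ) + 1 ≤ r := by exact_mod_cast i.isLt
  rw [tent, mul_evalTime hr, Fin.val_last, abs_of_nonneg (by linarith)]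
  exact max_eq_left (by linarith)

/-- The polygonal path through `-y_1, …, -y_{s-1}, y_s` which visits `y_s` between any two
consecutive vertices. -/
def zigzag {m r : ℕ} (y : SphProd m r) (t : I) : EuclideanSpace ℝ (Fin (m + 1)) :=
  (1 - ∑ i, tent r i t) • (y (Fin.last r) : EuclideanSpace ℝ (Fin (m + 1))) -
    ∑ i : Fin r, tent r i t • (y i.castSucc : EuclideanSpace ℝ (Fin (m + 1)))

theorem continuous_zigzag (m r : ℕ) :
    Continuous fun z : SphProd m r × I => zigzag z.1 z.2 := by
  have := continuous_tent r
  unfold zigzag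
  fun_prop

theorem zigzag_neg {m r : ℕ} (y : SphProd m r) (t : I) : zigzag (-y) t = -zigzag y t := by
  simp [zigzag, Finset.sum_neg_distrib]
  abel

theorem zigzag_of_tent_pos {m r : ℕ} (y : SphProd m r) {t : I} {i : Fin r} (hi : 0 < tent r i t) :
    zigzag y t = (1 - tent r i t) • (y (Fin.last r) : EuclideanSpace ℝ (Fin (m + 1))) -
      tent r i t • (y i.castSucc : EuclideanSpace ℝ (Fin (m + 1))) := by
  rw [zigzag, Finset.sum_eq_single i, Finset.sum_eq_single i] <;>
    simp +contextual [tent_eq_zero_of_ne hi]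

theorem zigzag_of_tent_eq_zero {m r : ℕ} (y : SphProd m r) {t : I} (h : ∀ i, tent r i t = 0) :
    zigzag y t = y (Fin.last r) := by
  simp [zigzag, h]

/-- If (1 - a) y_s = a y_i with unit vectors, comparing norms gives 1 - a = a, whence y_i = y_s,
which is excluded off D_s. -/
theorem zigzag_ne_zero {m r : ℕ} {y : SphProd m r} (hy : y ∉ pivotDiag m r) (t : I) :
    zigzag y t ≠ 0 := by
  by_cases h : ∃ i, 0 < tent r i t
  · obtain ⟨i, hi⟩ := h
    rw [zigzag_of_tent_pos y hi, sub_ne_zero]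
    intro h
    have hle : tent r i t ≤ 1 :=
      max_le zero_le_one (by linarith [abs_nonneg (r * (t : ℝ) - (i : ℕ))])
    have hn := congrArg norm h
    rw [norm_smul, norm_smul, norm_eq_of_mem_sphere, norm_eq_of_mem_sphere, mul_one, mul_one,
      Real.norm_of_nonneg (by linarith), Real.norm_of_nonneg hi.le] at hn
    rw [hn] at h
    exact hy ⟨i, Subtype.ext (smul_right_injective _ hi.ne' h).symm⟩
  · push Not at h
    rw [zigzag_of_tent_eq_zero y fun i => (h i).antisymm (tent_nonneg r i t)]
    exact ne_zero_of_mem_unit_sphere _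

/-- The radial projection of a nonzero vector to the sphere. -/
noncomputable def radial {m : ℕ} (v : {v : EuclideanSpace ℝ (Fin (m + 1)) // v ≠ 0}) : Sph m :=
  ⟨‖v.1‖⁻¹ • v.1, by simp [norm_smul, v.2]⟩

theorem continuous_radial (m : ℕ) : Continuous (radial (m := m)) := by
  refine Continuous.subtype_mk (Continuous.smul (Continuous.inv₀ continuous_subtype_val.norm ?_)
    continuous_subtype_val) _
  exact fun v => norm_ne_zero_iff.2 v.2

theorem radial_eq {m : ℕ} {v : {v : EuclideanSpace ℝ (Fin (m + 1)) // v ≠ 0}} {x : Sph m}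
    (h : v.1 = x) : radial v = x :=
  Subtype.ext (by simp [radial, h])

theorem radial_neg {m : ℕ} {v w : {v : EuclideanSpace ℝ (Fin (m + 1)) // v ≠ 0}}
    (h : w.1 = -v.1) : radial w = -radial v :=
  Subtype.ext (by simp [radial, h])

/-- The path in `ℝP^m` through `[y_1], …, [y_s]` traced by `zigzag y`. -/
noncomputable def pivotPath (m r : ℕ) : C({y : SphProd m r // y ∉ pivotDiag m r}, C(I, RProj m)) :=
  ContinuousMap.curry
    ⟨fun z => sphProj m (radial ⟨zigzag z.1.1 z.2, zigzag_ne_zero z.1.2 z.2⟩),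
      (sphProj_isQuotientCoveringMap m).continuous.comp <| (continuous_radial m).comp <|
        ((continuous_zigzag m r).comp
          (continuous_subtype_val.prodMap continuous_id)).subtype_mk _⟩

theorem pathEval_pivotPath {m r : ℕ} (hr : 1 ≤ r) (y : {y : SphProd m r // y ∉ pivotDiag m r}) :
    pathEval r (RProj m) (pivotPath m r y) = sphProdProj m r y.1 := by
  funext i
  change sphProj m (radial ⟨zigzag y.1 (evalTime r i), _⟩) = sphProj m (y.1 i)
  refine Fin.lastCases ?_ (fun i => ?_) i
  · exact congrArg _ (radial_eq (zigzag_of_tent_eq_zero _ (tent_evalTime_last hr)))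
  · rw [← sphProj_neg (y.1 i.castSucc)]
    refine congrArg _ (radial_eq ?_)
    have h1 := tent_evalTime_castSucc hr i
    simp [zigzag_of_tent_pos y.1 (h1.symm ▸ zero_lt_one), h1]

theorem pivotPath_neg {m r : ℕ} {y z : {y : SphProd m r // y ∉ pivotDiag m r}}
    (h : z.1 = -y.1) : pivotPath m r z = pivotPath m r y := by
  refine ContinuousMap.ext fun t => ?_
  refine (congrArg (sphProj m) (radial_neg ?_)).trans (sphProj_neg _)
  change zigzag z.1 t = _
  rw [h, zigzag_neg]

/-- Open sets of configurations off the pivotal diagonals, each meeting the fibres of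
`(S^m)^s → (ℝP^m)^s` in at most one antipodal pair, give a motion planner if their images cover. -/
theorem nonempty_motionPlanner {m r n : ℕ} (hr : 1 ≤ r) (O : Fin n → Set (SphProd m r))
    (hO : ∀ j, IsOpen (O j)) (hdiag : ∀ j, ∀ y ∈ O j, y ∉ pivotDiag m r)
    (hfib : ∀ j, ∀ y ∈ O j, ∀ z ∈ O j, sphProdProj m r y = sphProdProj m r z → z = y ∨ z = -y)
    (hcov : ∀ x : SphProd m r, ∃ j, ∃ y ∈ O j, sphProdProj m r y = sphProdProj m r x) :
    Nonempty (MotionPlanner r (RProj m) n) := by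
  have hq := sphProdProj_isOpenQuotientMap m r
  have hsec (j : Fin n) : ∃ s : C(sphProdProj m r '' O j, C(I, RProj m)),
      ∀ b, pathEval r (RProj m) (s b) = b := by
    let P : C(O j, sphProdProj m r '' O j) :=
      ⟨(Set.mapsTo_image (sphProdProj m r) (O j)).restrict, hq.continuous.restrict _⟩
    have hP : IsQuotientMap P := by
      -- The path assignment will descend along O_j → image, an open surjection because O_j is open.
      refine IsOpenMap.isQuotientMap ?_ P.continuous
        (Set.surjective_mapsTo_image_restrict (sphProdProj m r) (O j))
      exact (hq.isOpenMap.comp (hO j).isOpenMap_subtype_val).subtype_mk _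
    let F : C(O j, C(I, RProj m)) := (pivotPath m r).comp
      ⟨fun y => ⟨y.1, hdiag j y.1 y.2⟩, by fun_prop⟩
    have hF : Function.FactorsThrough F P := by
      intro y z hyz
      rcases hfib j y.1 y.2 z.1 z.2 (congrArg Subtype.val hyz) with h | h
      · rw [Subtype.ext h]
      · exact (pivotPath_neg h).symm
    refine ⟨hP.lift F hF, fun b => ?_⟩
    obtain ⟨y, rfl⟩ := hP.surjective b
    have : hP.lift F hF (P y) = F y := DFunLike.congr_fun (hP.lift_comp F hF) y
    rw [this]
    exact pathEval_pivotPath hr _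
  choose s hs using hsec
  refine ⟨⟨fun j => ⟨_, hq.isOpenMap _ (hO j)⟩, fun b => ?_, s, hs⟩⟩
  obtain ⟨x, rfl⟩ := hq.surjective b
  obtain ⟨j, y, hy, hyx⟩ := hcov x
  exact ⟨j, y, hy, hyx⟩

/-! ### Equivariance under all sign changes -/

theorem prod_sigmaGen (r : ℕ) : ∏ i : Fin r, sigmaGen i = fun _ => (-1 : ℤˣ) :=
  Finset.univ_prod_mulSingle fun _ : Fin r => (-1 : ℤˣ)

theorem sphProdProj_signAction {m r : ℕ} (g : SignGroup r) (x : SphProd m r) :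
    sphProdProj m r (g • x) = sphProdProj m r x := by
  funext i
  change sphProj m ((g • x) i) = sphProj m (x i)
  refine Fin.lastCases ?_ (fun i => ?_) i
  · rw [signAction_last]
  · rw [signAction_castSucc]
    exact (sphProj_isQuotientCoveringMap m).map_smul _

/-- Two configurations with the same projection differ by an element of `G_s`, after possibly
changing the sign of the last coordinate. -/
theorem exists_signAction_eq {m r : ℕ} {y z : SphProd m r}
    (h : sphProdProj m r y = sphProdProj m r z) : ∃ g : SignGroup r, z = g • y ∨
      z = Function.update (g • y) (Fin.last r) (-y (Fin.last r)) := by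
  choose e he using fun i => sphProj_eq_iff.1 (congrFun h i).symm
  refine ⟨fun i => e i.castSucc, ?_⟩
  rcases Int.units_eq_one_or (e (Fin.last r)) with h1 | h1
  · refine Or.inl (funext fun i => ?_)
    refine Fin.lastCases ?_ (fun i => ?_) i
    · rw [signAction_last, he, h1, one_smul]
    · rw [signAction_castSucc, he]
  · refine Or.inr (funext fun i => ?_)
    refine Fin.lastCases ?_ (fun i => ?_) i
    · rw [Function.update_self, he, h1, neg_one_smul_sph]
    · rw [Function.update_of_ne (Fin.castSucc_lt_last i).ne, signAction_castSucc, he]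

/-- Left translation is free on the vertices of the j-th factor, so among the 2^s sign changes only
those acting trivially there keep φ in the same star: the identity and the global antipode. -/
theorem eq_or_eq_neg_of_mem_joinStar {m r k : ℕ} {φ : SphProd m r → JoinPower k (SignGroup r)}
    (hequiv : ∀ (g : SignGroup r) (x : SphProd m r), φ (g • x) = g • φ x)
    (hlast : ∀ x : SphProd m r,
      φ (Function.update x (Fin.last r) (-x (Fin.last r))) = (∏ i : Fin r, sigmaGen i) • φ x)
    {j : Fin (k + 1)} {g : SignGroup r} {y z : SphProd m r} (hy : φ y ∈ joinStar j g)
    (hz : φ z ∈ joinStar j g) (h : sphProdProj m r y = sphProdProj m r z) : z = y ∨ z = -y := by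
  obtain ⟨a, rfl | rfl⟩ := exists_signAction_eq h
  · rw [hequiv] at hz
    have ha : a = 1 := mul_eq_right.1 (eq_of_mem_joinStar (smul_mem_joinStar a hy) hz)
    exact Or.inl (by rw [ha, one_smul])
  · rw [← signAction_last a y, hlast, hequiv] at hz
    have ha := eq_of_mem_joinStar (smul_mem_joinStar _ (smul_mem_joinStar a hy)) hz
    -- Cancelling the vertex g leaves σ_1 ⋯ σ_{s-1} a = 1, so every a_i is -1.
    rw [← mul_assoc, mul_eq_right, prod_sigmaGen] at ha
    refine Or.inr (funext fun i => ?_)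
    refine Fin.lastCases ?_ (fun i => ?_) i
    · simp
    · have hi : a i = -1 := by simpa [neg_eq_iff_eq_neg] using congrFun ha i
      rw [Function.update_of_ne (Fin.castSucc_lt_last i).ne, signAction_castSucc, hi,
        neg_one_smul_sph, Pi.neg_apply]

/-- The motion planner given by a choice of one vertex in each join factor. -/
theorem nonempty_motionPlanner_of_joinStar {m r k : ℕ} (hr : 1 ≤ r)
    (φ : C(SphProd m r, JoinPower k (SignGroup r)))
    (hequiv : ∀ (g : SignGroup r) (x : SphProd m r), φ (g • x) = g • φ x)
    (hlast : ∀ x : SphProd m r,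
      φ (Function.update x (Fin.last r) (-x (Fin.last r))) = (∏ i : Fin r, sigmaGen i) • φ x)
    (v : Fin (k + 1) → SignGroup r)
    (hcov : ∀ x, ∃ j, φ x ∈ joinOpen j ∧
      ∀ a : SignGroup r, φ (a • x) ∈ joinStar j (v j) → a • x ∉ pivotDiag m r) :
    Nonempty (MotionPlanner r (RProj m) (k + 1)) := by
  refine nonempty_motionPlanner hr (fun j => φ ⁻¹' joinStar j (v j) \ pivotDiag m r)
    (fun j => ((isOpen_joinStar j (v j)).preimage φ.continuous).sdiff ?_) (fun j y hy => hy.2)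
    (fun j y hy z hz h => eq_or_eq_neg_of_mem_joinStar hequiv hlast hy.1 hz.1 h) fun x => ?_
  · rw [pivotDiag, Set.ofPred_exists]
    exact isClosed_iUnion_of_finite fun i => isClosed_eq (continuous_apply _) (continuous_apply _)
  · obtain ⟨j, hj, ha⟩ := hcov x
    obtain ⟨g, hg⟩ := mem_joinOpen_iff.1 hj
    -- Translating by v_j g⁻¹ moves the vertex g to v_j without leaving the fibre of x.
    have hmem : φ ((v j * g⁻¹) • x) ∈ joinStar j (v j) := by
      rw [hequiv]
      simpa using smul_mem_joinStar (v j * g⁻¹) hg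
    exact ⟨j, _, ⟨hmem, ha _ hmem⟩, sphProdProj_signAction _ _⟩

/-- Here `s = r + 1`, and `J_k(G_s)` is taken for `k = secat(π_s)`, read as a natural number. -/
theorem proposition3p3 (m r : ℕ) (hm : 1 ≤ m) (hr : 1 ≤ r)
    (φ : C(SphProd m r, JoinPower (secat (projProdCover m r)).toNat (SignGroup r)))
    (hequiv : ∀ (g : SignGroup r) (x : SphProd m r), φ (g • x) = g • φ x)
    (hlast : ∀ x : SphProd m r,
      φ (Function.update x (Fin.last r) (-x (Fin.last r))) = (∏ i : Fin r, sigmaGen i) • φ x)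
    (hD :
      (∀ j, ∀ C C', IsComponentOf C (joinOpen j) → IsComponentOf C' (joinOpen j) →
        (φ '' pivotDiag m r ∩ C).Nonempty → (φ '' pivotDiag m r ∩ C').Nonempty → C = C') ∨
      (∃ j, ∃ C, IsComponentOf C (joinOpen j) ∧ φ '' pivotDiag m r ⊆ C)) :
    Nonempty (MotionPlanner r (RProj m) ((secat (projProdCover m r)).toNat + 1)) ∧
      higherTC r (RProj m) = secat (projProdCover m r) := by
  -- Supplies the coordinate 0 of G_s at which two vertices are seen to differ.
  have : NeZero r := ⟨by omega⟩
  have hplan : Nonempty (MotionPlanner r (RProj m) ((secat (projProdCover m r)).toNat + 1)) := by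
    rcases hD with hD | ⟨j₀, C, ⟨p, hp, rfl⟩, hC⟩
    · have hv (j) : ∃ g : SignGroup r, ∀ y ∈ pivotDiag m r, φ y ∉ joinStar j g := by
        by_contra! h
        obtain ⟨y, hy, hy1⟩ := h 1
        obtain ⟨z, hz, hz1⟩ := h (-1)
        have hyU := joinStar_subset_joinOpen hy1
        have hzU := joinStar_subset_joinOpen hz1
        have heq := hD j _ _ ⟨_, hyU, rfl⟩ ⟨_, hzU, rfl⟩
          ⟨_, ⟨y, hy, rfl⟩, mem_connectedComponentIn hyU⟩
          ⟨_, ⟨z, hz, rfl⟩, mem_connectedComponentIn hzU⟩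
        have hz1' := connectedComponentIn_subset_joinStar hy1
          (heq ▸ mem_connectedComponentIn hzU : φ z ∈ connectedComponentIn (joinOpen j) (φ y))
        exact absurd (congrFun (eq_of_mem_joinStar hz1' hz1) 0)
          (by decide : (1 : ℤˣ) ≠ -1)
      choose v hv using hv
      refine nonempty_motionPlanner_of_joinStar hr φ hequiv hlast v fun x => ?_
      obtain ⟨j, hj⟩ := exists_mem_joinOpen (φ x)
      exact ⟨j, hj, fun a ha hax => hv j _ hax ha⟩
    · obtain ⟨g, hg⟩ := mem_joinOpen_iff.1 hp
      have hφ : ∀ y ∈ pivotDiag m r, φ y ∈ joinStar j₀ g := fun y hy =>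
        connectedComponentIn_subset_joinStar hg (hC ⟨y, hy, rfl⟩)
      -- Any vertex other than g serves in factor j₀, since D_s lands in the star of g; the vertices
      -- of the other factors are arbitrary.
      refine nonempty_motionPlanner_of_joinStar hr φ hequiv hlast (fun _ => -g) fun x => ?_
      by_cases hx : φ x ∈ joinOpen j₀
      · refine ⟨j₀, hx, fun a ha hax => ?_⟩
        have := congrFun (eq_of_mem_joinStar (hφ _ hax) ha) 0
        exact units_ne_neg_self (g 0) this
      -- U_{j₀} is G_s-invariant and contains φ(D_s), so here the whole orbit of x avoids D_s.
      · obtain ⟨j, hj⟩ := exists_mem_joinOpen (φ x)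
        refine ⟨j, hj, fun a _ hax => hx ?_⟩
        have := smul_mem_joinStar a⁻¹ (hφ _ hax)
        rw [hequiv, inv_smul_smul] at this
        exact joinStar_subset_joinOpen this
  refine ⟨hplan, le_antisymm ?_ (secat_projProdCover_le_higherTC m r)⟩
  obtain ⟨S⟩ := hplan
  -- Finiteness of secat(π_s) is not needed: `toNat` sends ⊤ to 0, so the inequality holds in either
  -- case.
  exact (secat_le_of_localSections S).trans (ENat.natCast_toNat_le_self _)
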